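/- Let $N\ge 2$, $m\ge 1$ and $1\le K\le N$ be integers, let $D\in\mathbb R^{m\times N}$ have columns of Euclidean norm one, let $x\in\mathbb R^N$ have at most $K$ non-zero entries, and let $\sigma>0$ and $a>-1$ be real numbers. Let $e$ be a random vector in $\mathbb R^m$ with independent $N(0,\sigma^2)$ entries (white Gaussian noise), and let $y=Dx+e$. Let $\delta=\delta_{4K}$ be the restricted isometry constant of $D$ of order $4K$, i.e. the smallest number such that $(1-\delta)\|z\|_2^2\le\|Dz\|_2^2\le(1+\delta)\|z\|_2^2$ for all $z\in\mathbb R^N$ with at most $4K$ non-zero entries, and put $$C_{CoSaMP}=\frac{29-14\delta+\delta^2}{(1-\delta)^2}.$$ For an index set $S\subseteq\{1,\dots,N\}$ let $D_S$ be the matrix of the columns of $D$ indexed by $S$, let $D_S^\dagger$ be its pseudoinverse, let $^*$ denote the transpose, and let $z_S$ be the restriction of a vector $z$ to $S$. Let $\operatorname{supp}(z,k)$ be the set of the positions of $k$ entries of $z$ of largest magnitude (all positions if $k\ge N$), with ties broken arbitrarily. The CoSaMP algorithm starts from $T^0=\emptyset$, $\hat x^0=0$, $y_r^0=y$, and in iteration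 $\ell\ge 1$ it computes $T_\Delta=\operatorname{supp}(D^*y_r^{\ell-1},2K)$, $\tilde T=T^{\ell-1}\cup T_\Delta$, the vector $x_p\in\mathbb R^N$ that equals $D_{\tilde T}^\dagger y$ on $\tilde T$ and $0$ elsewhere, $T^\ell=\operatorname{supp}(x_p,K)$, the estimate $\hat x^\ell$ that equals $x_p$ on $T^\ell$ and $0$ elsewhere, and the residual $y_r^\ell=y-D_{T^\ell}(x_p)_{T^\ell}=y-D\hat x^\ell$. Let $$\ell^*=\left\lceil\log_2\frac{\|x\|_2}{\max_{|S|=K}\|D_S^*e\|_2}\right\rceil,$$ replaced by $0$ if this is negative or if $x=0$. If $\delta_{4K}\le 0.1$, then $C_{CoSaMP}\le 34.1$, and with probability exceeding $1-\left(\sqrt{\pi(1+a)\log N}\cdot N^a\right)^{-1}$ the CoSaMP output $\hat x_{CoSaMP}=\hat x^{\ell}$ after any number $\ell\ge\ell^*$ of iterations, however ties are broken, satisfies $$\|x-\hat x_{CoSaMP}\|_2^2\le C_{CoSaMP}^2\cdot\bigl(2(1+a)\log N\bigr)\cdot K\sigma^2 .$$ -/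

import Mathlib

open MeasureTheory ProbabilityTheory

noncomputable section

namespace CoSaMP

variable {m N : ℕ}

/-- `x` is `k`-sparse: at most `k` of its entries are non-zero. -/
def IsSparse (k : ℕ) (x : EuclideanSpace ℝ (Fin N)) : Prop :=
  (Finset.univ.filter fun i => x i ≠ 0).card ≤ k

/-- The restricted isometry constant `δ_k` of `D`: the smallest `δ` such that
`(1 - δ) ‖x‖² ≤ ‖D x‖² ≤ (1 + δ) ‖x‖²` for every `k`-sparse `x`. -/
def ripConst (D : Matrix (Fin m) (Fin N) ℝ) (k : ℕ) : ℝ :=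
  sInf {δ : ℝ | ∀ x : EuclideanSpace ℝ (Fin N), IsSparse k x →
    (1 - δ) * ‖x‖ ^ 2 ≤ ‖D.toEuclideanLin x‖ ^ 2 ∧
      ‖D.toEuclideanLin x‖ ^ 2 ≤ (1 + δ) * ‖x‖ ^ 2}

/-- All columns of `D` have Euclidean norm one. -/
def HasNormalizedColumns (D : Matrix (Fin m) (Fin N) ℝ) : Prop :=
  ∀ j, ‖(WithLp.toLp 2 (fun i => D i j) : EuclideanSpace ℝ (Fin m))‖ = 1

/-- `D_S`: the columns of `D` with index in `S`. -/
def subCols (D : Matrix (Fin m) (Fin N) ℝ) (S : Finset (Fin N)) : Matrix (Fin m) S ℝ :=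
  D.submatrix id Subtype.val

/-- The Moore-Penrose pseudoinverse `A† = (Aᵀ A)⁻¹ Aᵀ` of a matrix of full column rank. The algorithm
applies it to at most `3 K` columns of `D`, and these are linearly independent
when `δ_{4K} < 1`. -/
def pinv {ι κ : Type*} [Fintype ι] [Fintype κ] [DecidableEq κ] (A : Matrix ι κ ℝ) :
    Matrix κ ι ℝ :=
  (A.transpose * A)⁻¹ * A.transpose

/-- The four Penrose equations, for a matrix of full column rank. -/
theorem pinv_penrose {ι κ : Type*} [Fintype ι] [Fintype κ] [DecidableEq κ] (A : Matrix ι κ ℝ)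
    (h : IsUnit (A.transpose * A).det) :
    A * pinv A * A = A ∧ pinv A * A * pinv A = pinv A ∧
      (A * pinv A).transpose = A * pinv A ∧ (pinv A * A).transpose = pinv A * A := by
  have h1 : pinv A * A = 1 := by
    rw [pinv, Matrix.mul_assoc, Matrix.nonsing_inv_mul _ h]
  refine ⟨by rw [Matrix.mul_assoc, h1, Matrix.mul_one], by rw [h1, Matrix.one_mul], ?_,
    by rw [h1, Matrix.transpose_one]⟩
  simp [pinv, Matrix.transpose_mul, Matrix.transpose_nonsing_inv, Matrix.mul_assoc]

/-- The vector that agrees with `z` on `S` and vanishes outside `S`. -/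
def restrictTo (S : Finset (Fin N)) (z : EuclideanSpace ℝ (Fin N)) : EuclideanSpace ℝ (Fin N) :=
  WithLp.toLp 2 fun i => if i ∈ S then z i else 0

/-- The representation `D_S† y`, extended by zero to a vector indexed by all columns of `D`. -/
def represent (D : Matrix (Fin m) (Fin N) ℝ) (S : Finset (Fin N)) (y : EuclideanSpace ℝ (Fin m)) :
    EuclideanSpace ℝ (Fin N) :=
  WithLp.toLp 2 fun i => if h : i ∈ S then (pinv (subCols D S)).toEuclideanLin y ⟨i, h⟩ else 0

/-- `S` is a possible value of `supp(z, k)`: it consists of the positions of `k` entries of `z` of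
largest magnitude (all positions if `k ≥ N`), with ties broken arbitrarily. -/
def IsLargestSupport (z : EuclideanSpace ℝ (Fin N)) (k : ℕ) (S : Finset (Fin N)) : Prop :=
  S.card = min k N ∧ ∀ i ∈ S, ∀ j ∉ S, |z j| ≤ |z i|

/-- `Iterate K D y ℓ T xhat`: a run of CoSaMP with sparsity level `K` on the input `D`, `y` can hold
the support `T` and the estimate `xhat` after `ℓ` iterations. The residual is `y - D xhat`, which
is `y` at the start and `y - D_T (x_p)_T` after each iteration. -/
inductive Iterate (K : ℕ) (D : Matrix (Fin m) (Fin N) ℝ) (y : EuclideanSpace ℝ (Fin m)) :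
    ℕ → Finset (Fin N) → EuclideanSpace ℝ (Fin N) → Prop
  | init : Iterate K D y 0 ∅ 0
  | step {ℓ : ℕ} {T : Finset (Fin N)} {xhat : EuclideanSpace ℝ (Fin N)}
      {TΔ T' : Finset (Fin N)} (prev : Iterate K D y ℓ T xhat)
      (select : IsLargestSupport
        (D.transpose.toEuclideanLin (y - D.toEuclideanLin xhat)) (2 * K) TΔ)
      (prune : IsLargestSupport (represent D (T ∪ TΔ) y) K T') :
      Iterate K D y (ℓ + 1) T' (restrictTo T' (represent D (T ∪ TΔ) y))

theorem exists_isLargestSupport (z : EuclideanSpace ℝ (Fin N)) (k : ℕ) :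
    ∃ S, IsLargestSupport z k S := by
  induction k with
  | zero => exact ⟨∅, by simp, by simp⟩
  | succ k ih =>
    obtain ⟨S, hc, hS⟩ := ih
    by_cases hk : N ≤ k
    · exact ⟨S, by omega, hS⟩
    · have hne : (Sᶜ).Nonempty := by
        rw [← Finset.card_pos, Finset.card_compl, Fintype.card_fin]
        omega
      obtain ⟨p, hp, hmax⟩ := Finset.exists_max_image Sᶜ (fun j => |z j|) hne
      have hpS : p ∉ S := Finset.mem_compl.mp hp
      refine ⟨insert p S, by rw [Finset.card_insert_of_notMem hpS]; omega, ?_⟩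
      intro i hi j hj
      rw [Finset.mem_insert, not_or] at hj
      rcases Finset.mem_insert.mp hi with rfl | hi
      · exact hmax j (Finset.mem_compl.mpr hj.2)
      · exact hS i hi j hj.2

/-- On every input CoSaMP can be run for any number of iterations. -/
theorem exists_iterate (K : ℕ) (D : Matrix (Fin m) (Fin N) ℝ) (y : EuclideanSpace ℝ (Fin m))
    (ℓ : ℕ) : ∃ T xhat, Iterate K D y ℓ T xhat := by
  induction ℓ with
  | zero => exact ⟨∅, 0, Iterate.init⟩
  | succ ℓ ih =>
    obtain ⟨T, xhat, h⟩ := ih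
    obtain ⟨TΔ, hΔ⟩ := exists_isLargestSupport
      (D.transpose.toEuclideanLin (y - D.toEuclideanLin xhat)) (2 * K)
    obtain ⟨T', hT'⟩ := exists_isLargestSupport (represent D (T ∪ TΔ) y) K
    exact ⟨T', _, Iterate.step h hΔ hT'⟩

/-- `‖D_{T_e}ᵀ e‖`, where `T_e` maximizes `‖D_Sᵀ e‖` over all sets `S` of `K` columns. -/
def noiseCorr (D : Matrix (Fin m) (Fin N) ℝ) (K : ℕ) (e : EuclideanSpace ℝ (Fin m)) : ℝ :=
  ⨆ S : {S : Finset (Fin N) // S.card = K}, ‖(subCols D S.1).transpose.toEuclideanLin e‖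

/-- The number of iterations `ℓ* = ⌈log₂ (‖x‖ / ‖D_{T_e}ᵀ e‖)⌉`, read as `0` when this is negative
and when `x = 0`. -/
def iterationCount (D : Matrix (Fin m) (Fin N) ℝ) (K : ℕ) (x : EuclideanSpace ℝ (Fin N))
    (e : EuclideanSpace ℝ (Fin m)) : ℕ :=
  ⌈Real.logb 2 (‖x‖ / noiseCorr D K e)⌉₊

/-- The constant `C_CoSaMP` as a function of `δ = δ_{4K}`. -/
def errorConst (δ : ℝ) : ℝ :=
  (29 - 14 * δ + δ ^ 2) / (1 - δ) ^ 2

/-- White Gaussian noise with variance `σ²`: the entries of `e` are independent and each is centred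
normal with variance `σ²`. -/
structure IsWhiteGaussianNoise {Ω : Type*} [MeasurableSpace Ω] (μ : Measure Ω)
    (e : Ω → EuclideanSpace ℝ (Fin m)) (σ : ℝ) : Prop where
  indep : iIndepFun (fun i ω => e ω i) μ
  law : ∀ i, HasLaw (fun ω => e ω i) (gaussianReal 0 (Real.toNNReal (σ ^ 2))) μ

end CoSaMP

end

namespace CoSaMP

variable {m N : ℕ}

@[simp]
theorem restrictTo_apply (S : Finset (Fin N)) (z : EuclideanSpace ℝ (Fin N)) (i : Fin N) :
    restrictTo S z i = if i ∈ S then z i else 0 := rfl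

theorem restrictTo_add (S : Finset (Fin N)) (u v : EuclideanSpace ℝ (Fin N)) :
    restrictTo S (u + v) = restrictTo S u + restrictTo S v := by
  ext i
  by_cases h : i ∈ S <;> simp [h]

theorem restrictTo_sub (S : Finset (Fin N)) (u v : EuclideanSpace ℝ (Fin N)) :
    restrictTo S (u - v) = restrictTo S u - restrictTo S v := by
  ext i
  by_cases h : i ∈ S <;> simp [h]

theorem restrictTo_eq_self {S : Finset (Fin N)} {z : EuclideanSpace ℝ (Fin N)}
    (h : ∀ i ∉ S, z i = 0) : restrictTo S z = z := by
  ext i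
  by_cases hi : i ∈ S <;> simp [hi, h]

theorem norm_sq_restrictTo (S : Finset (Fin N)) (z : EuclideanSpace ℝ (Fin N)) :
    ‖restrictTo S z‖ ^ 2 = ∑ i ∈ S, z i ^ 2 := by
  rw [EuclideanSpace.real_norm_sq_eq]
  simp [ite_pow]

theorem norm_restrictTo_mono {S T : Finset (Fin N)} (h : S ⊆ T) (z : EuclideanSpace ℝ (Fin N)) :
    ‖restrictTo S z‖ ≤ ‖restrictTo T z‖ := by
  rw [← sq_le_sq₀ (norm_nonneg _) (norm_nonneg _), norm_sq_restrictTo, norm_sq_restrictTo]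
  exact Finset.sum_le_sum_of_subset_of_nonneg h fun _ _ _ => sq_nonneg _

theorem norm_restrictTo_union_le (S T : Finset (Fin N)) (z : EuclideanSpace ℝ (Fin N)) :
    ‖restrictTo (S ∪ T) z‖ ≤ ‖restrictTo S z‖ + ‖restrictTo T z‖ := by
  refine abs_le_of_sq_le_sq' ?_ (by positivity) |>.2
  have h : ‖restrictTo (S ∪ T) z‖ ^ 2 ≤ ‖restrictTo S z‖ ^ 2 + ‖restrictTo T z‖ ^ 2 := by
    simp only [norm_sq_restrictTo]
    rw [← Finset.sum_union_inter]
    exact le_add_of_nonneg_right (Finset.sum_nonneg fun _ _ => sq_nonneg _)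
  nlinarith [norm_nonneg (restrictTo S z), norm_nonneg (restrictTo T z)]

theorem norm_le_restrictTo_add_compl (S : Finset (Fin N)) (z : EuclideanSpace ℝ (Fin N)) :
    ‖z‖ ≤ ‖restrictTo S z‖ + ‖restrictTo Sᶜ z‖ := by
  have h := norm_restrictTo_union_le S Sᶜ z
  rwa [Finset.union_compl, restrictTo_eq_self (by simp)] at h

theorem inner_restrictTo_self (S : Finset (Fin N)) (z : EuclideanSpace ℝ (Fin N)) :
    inner ℝ z (restrictTo S z) = ‖restrictTo S z‖ ^ 2 := by
  rw [norm_sq_restrictTo, PiLp.inner_apply]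
  simp [sq]

theorem isSparse_of_forall_notMem {k : ℕ} {S : Finset (Fin N)} (hS : S.card ≤ k)
    {z : EuclideanSpace ℝ (Fin N)} (h : ∀ i ∉ S, z i = 0) : IsSparse k z := by
  refine (Finset.card_le_card fun i hi => ?_).trans hS
  by_contra hiS
  exact (Finset.mem_filter.mp hi).2 (h i hiS)

theorem ripConst_bddBelow (D : Matrix (Fin m) (Fin N) ℝ) (hD : HasNormalizedColumns D)
    {k : ℕ} (hk : 1 ≤ k) (j : Fin N) :
    ∀ δ ∈ {δ : ℝ | ∀ x : EuclideanSpace ℝ (Fin N), IsSparse k x →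
      (1 - δ) * ‖x‖ ^ 2 ≤ ‖D.toEuclideanLin x‖ ^ 2 ∧
        ‖D.toEuclideanLin x‖ ^ 2 ≤ (1 + δ) * ‖x‖ ^ 2}, 0 ≤ δ := by
  intro δ hδ
  have hs : IsSparse k (EuclideanSpace.single j (1 : ℝ)) := by
    refine isSparse_of_forall_notMem (S := {j}) (by simpa using hk) fun i hi => ?_
    simp at hi
    simp [hi]
  have h := (hδ _ hs).1
  have hcol : D.toEuclideanLin (EuclideanSpace.single j (1 : ℝ)) =
      WithLp.toLp 2 (fun i => D i j) := by
    ext i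
    simp [Matrix.toLpLin_apply]
  rw [hcol, hD j] at h
  simp at h
  exact h

theorem ripConst_nonneg (D : Matrix (Fin m) (Fin N) ℝ) (hD : HasNormalizedColumns D)
    {k : ℕ} (hk : 1 ≤ k) (j : Fin N) : 0 ≤ ripConst D k :=
  Real.sInf_nonneg (ripConst_bddBelow D hD hk j)

/-- The infimum defining the restricted isometry constant is attained. -/
theorem ripConst_spec (D : Matrix (Fin m) (Fin N) ℝ) (k : ℕ) {z : EuclideanSpace ℝ (Fin N)}
    (hz : IsSparse k z) :
    (1 - ripConst D k) * ‖z‖ ^ 2 ≤ ‖D.toEuclideanLin z‖ ^ 2 ∧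
      ‖D.toEuclideanLin z‖ ^ 2 ≤ (1 + ripConst D k) * ‖z‖ ^ 2 := by
  rcases eq_or_ne z 0 with rfl | hz0
  · simp
  have hpos : 0 < ‖z‖ ^ 2 := by positivity
  have hne : {δ : ℝ | ∀ x : EuclideanSpace ℝ (Fin N), IsSparse k x →
      (1 - δ) * ‖x‖ ^ 2 ≤ ‖D.toEuclideanLin x‖ ^ 2 ∧
        ‖D.toEuclideanLin x‖ ^ 2 ≤ (1 + δ) * ‖x‖ ^ 2}.Nonempty := by
    refine ⟨1 + ‖D.toEuclideanLin.toContinuousLinearMap‖ ^ 2, fun x _ => ?_⟩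
    have h := D.toEuclideanLin.toContinuousLinearMap.le_opNorm x
    have h2 := pow_le_pow_left₀ (norm_nonneg _) h 2
    rw [mul_pow] at h2
    simp only [LinearMap.coe_toContinuousLinearMap'] at h2
    constructor <;> nlinarith [sq_nonneg ‖x‖, sq_nonneg ‖D.toEuclideanLin x‖,
      mul_nonneg (sq_nonneg ‖D.toEuclideanLin.toContinuousLinearMap‖) (sq_nonneg ‖x‖)]
  constructor
  · have h : 1 - ‖D.toEuclideanLin z‖ ^ 2 / ‖z‖ ^ 2 ≤ ripConst D k :=
      le_csInf hne fun δ hδ => by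
        have := (le_div_iff₀ hpos).mpr (hδ z hz).1
        linarith
    rw [← le_div_iff₀ hpos]
    linarith
  · have h : ‖D.toEuclideanLin z‖ ^ 2 / ‖z‖ ^ 2 - 1 ≤ ripConst D k :=
      le_csInf hne fun δ hδ => by
        have := (div_le_iff₀ hpos).mpr (hδ z hz).2
        linarith
    rw [← div_le_iff₀ hpos]
    linarith

theorem inner_toEuclideanLin_transpose (D : Matrix (Fin m) (Fin N) ℝ)
    (y : EuclideanSpace ℝ (Fin m)) (z : EuclideanSpace ℝ (Fin N)) :
    inner ℝ (D.transpose.toEuclideanLin y) z = inner ℝ y (D.toEuclideanLin z) := by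
  rw [← Matrix.conjTranspose_eq_transpose_of_trivial,
    Matrix.toEuclideanLin_conjTranspose_eq_adjoint, LinearMap.adjoint_inner_left]

/-- Near-orthogonality: `D` almost preserves inner products of vectors with a common sparse
support. -/
theorem inner_sub_inner_le (D : Matrix (Fin m) (Fin N) ℝ) {k : ℕ}
    {U : Finset (Fin N)} (hU : U.card ≤ k) {u v : EuclideanSpace ℝ (Fin N)}
    (hu : ∀ i ∉ U, u i = 0) (hv : ∀ i ∉ U, v i = 0) :
    inner ℝ u v - inner ℝ (D.toEuclideanLin u) (D.toEuclideanLin v) ≤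
      ripConst D k * ‖u‖ * ‖v‖ := by
  have key : ∀ s : ℝ, 2 * s * (inner ℝ u v - inner ℝ (D.toEuclideanLin u) (D.toEuclideanLin v)) ≤
      ripConst D k * (‖u‖ ^ 2 + s ^ 2 * ‖v‖ ^ 2) := by
    intro s
    have h1 := (ripConst_spec D k (z := u + s • v)
      (isSparse_of_forall_notMem hU fun i hi => by simp [hu i hi, hv i hi])).1
    have h2 := (ripConst_spec D k (z := u - s • v)
      (isSparse_of_forall_notMem hU fun i hi => by simp [hu i hi, hv i hi])).2
    rw [map_add, map_smul, norm_add_sq_real, norm_add_sq_real, norm_smul, norm_smul,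
      inner_smul_right, inner_smul_right, mul_pow, mul_pow, Real.norm_eq_abs, sq_abs] at h1
    rw [map_sub, map_smul, norm_sub_sq_real, norm_sub_sq_real, norm_smul, norm_smul,
      inner_smul_right, inner_smul_right, mul_pow, mul_pow, Real.norm_eq_abs, sq_abs] at h2
    nlinarith
  rcases eq_or_ne v 0 with rfl | hv0
  · simp
  rcases eq_or_ne u 0 with rfl | hu0
  · simp
  have hvp : 0 < ‖v‖ := norm_pos_iff.mpr hv0
  have hup : 0 < ‖u‖ := norm_pos_iff.mpr hu0
  have h := key (‖u‖ / ‖v‖)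
  have e1 : ripConst D k * (‖u‖ ^ 2 + (‖u‖ / ‖v‖) ^ 2 * ‖v‖ ^ 2) =
      2 * (‖u‖ / ‖v‖) * (ripConst D k * ‖u‖ * ‖v‖) := by
    field_simp
    ring
  rw [e1] at h
  exact le_of_mul_le_mul_left h (by positivity)

/-- On a sparse set, `Dᵀ D` is close to the identity. -/
theorem norm_restrictTo_sub_gram_le (D : Matrix (Fin m) (Fin N) ℝ) {k : ℕ}
    (hδ : 0 ≤ ripConst D k) {U : Finset (Fin N)} (hU : U.card ≤ k)
    {h : EuclideanSpace ℝ (Fin N)} (hh : ∀ i ∉ U, h i = 0) :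
    ‖restrictTo U (h - D.transpose.toEuclideanLin (D.toEuclideanLin h))‖ ≤
      ripConst D k * ‖h‖ := by
  set w := h - D.transpose.toEuclideanLin (D.toEuclideanLin h) with hw
  rcases (norm_nonneg (restrictTo U w)).eq_or_lt with h0 | h0
  · rw [← h0]
    positivity
  have h1 := inner_sub_inner_le D hU hh (v := restrictTo U w) fun i hi => by simp [hi]
  rw [← inner_toEuclideanLin_transpose, ← inner_sub_left, ← hw, inner_restrictTo_self, sq] at h1
  exact le_of_mul_le_mul_right h1 h0

theorem norm_subCols_transpose (D : Matrix (Fin m) (Fin N) ℝ) (S : Finset (Fin N))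
    (e : EuclideanSpace ℝ (Fin m)) :
    ‖(subCols D S).transpose.toEuclideanLin e‖ =
      ‖restrictTo S (D.transpose.toEuclideanLin e)‖ := by
  rw [← sq_eq_sq₀ (norm_nonneg _) (norm_nonneg _), norm_sq_restrictTo,
    EuclideanSpace.real_norm_sq_eq]
  exact Finset.sum_coe_sort S fun i => D.transpose.toEuclideanLin e i ^ 2

theorem noiseCorr_nonneg (D : Matrix (Fin m) (Fin N) ℝ) (K : ℕ) (e : EuclideanSpace ℝ (Fin m)) :
    0 ≤ noiseCorr D K e :=
  Real.iSup_nonneg fun _ => norm_nonneg _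

theorem norm_restrictTo_le_noiseCorr (D : Matrix (Fin m) (Fin N) ℝ) {K : ℕ} (hKN : K ≤ N)
    (e : EuclideanSpace ℝ (Fin m)) {S : Finset (Fin N)} (hS : S.card ≤ K) :
    ‖restrictTo S (D.transpose.toEuclideanLin e)‖ ≤ noiseCorr D K e := by
  obtain ⟨U, hSU, -, hU⟩ := Finset.exists_subsuperset_card_eq (Finset.subset_univ S) hS
    (by simpa using hKN)
  refine (norm_restrictTo_mono hSU _).trans ?_
  rw [← norm_subCols_transpose]
  exact le_ciSup (f := fun S : {S : Finset (Fin N) // S.card = K} =>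
    ‖(subCols D S.1).transpose.toEuclideanLin e‖) (Set.finite_range _).bddAbove ⟨U, hU⟩

theorem norm_restrictTo_le_mul_noiseCorr (D : Matrix (Fin m) (Fin N) ℝ) {K : ℕ} (hKN : K ≤ N)
    (e : EuclideanSpace ℝ (Fin m)) (j : ℕ) {S : Finset (Fin N)} (hS : S.card ≤ j * K) :
    ‖restrictTo S (D.transpose.toEuclideanLin e)‖ ≤ j * noiseCorr D K e := by
  induction j generalizing S with
  | zero =>
    have : S = ∅ := by simpa using hS
    subst this
    rw [show restrictTo ∅ (D.transpose.toEuclideanLin e) = 0 by ext; simp]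
    simp
  | succ j ih =>
    obtain ⟨T, hTS, hT⟩ := Finset.exists_subset_card_eq (min_le_left S.card K)
    have hc := Finset.card_sdiff_add_card_eq_card hTS
    have h1 := ih (S := S \ T) (by rw [add_mul] at hS; omega)
    have h2 := norm_restrictTo_le_noiseCorr D hKN e (S := T) (by omega)
    have h3 := norm_restrictTo_union_le (S \ T) T (D.transpose.toEuclideanLin e)
    rw [Finset.sdiff_union_of_subset hTS] at h3
    push_cast
    linarith

/-- The largest entries carry at least as much energy as any set of at most as many entries. -/
theorem IsLargestSupport.norm_sdiff_le {z : EuclideanSpace ℝ (Fin N)} {k : ℕ}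
    {S R : Finset (Fin N)} (hS : IsLargestSupport z k S) (hR : R.card ≤ k) :
    ‖restrictTo (R \ S) z‖ ≤ ‖restrictTo (S \ R) z‖ := by
  rw [← sq_le_sq₀ (norm_nonneg _) (norm_nonneg _), norm_sq_restrictTo, norm_sq_restrictTo]
  rcases (R \ S).eq_empty_or_nonempty with h0 | ⟨j, hj⟩
  · rw [h0, Finset.sum_empty]
    exact Finset.sum_nonneg fun _ _ => sq_nonneg _
  have hRN : R.card ≤ N := by simpa using R.card_le_univ
  have hcard : (R \ S).card ≤ (S \ R).card := by
    have h1 := Finset.card_sdiff_add_card_inter R S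
    have h2 := Finset.card_sdiff_add_card_inter S R
    rw [Finset.inter_comm] at h2
    have := hS.1
    omega
  have hne : (S \ R).Nonempty := Finset.card_pos.mp
    ((Finset.card_pos.mpr ⟨j, hj⟩).trans_le hcard)
  obtain ⟨p, hp, hmin⟩ := Finset.exists_min_image (S \ R) (fun i => z i ^ 2) hne
  calc ∑ i ∈ R \ S, z i ^ 2 ≤ (R \ S).card • z p ^ 2 :=
        Finset.sum_le_card_nsmul _ _ _ fun i hi =>
          sq_le_sq.mpr (hS.2 p (Finset.mem_sdiff.mp hp).1 i (Finset.mem_sdiff.mp hi).2)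
    _ ≤ (S \ R).card • z p ^ 2 := nsmul_le_nsmul_left (sq_nonneg _) hcard
    _ ≤ ∑ i ∈ S \ R, z i ^ 2 := Finset.card_nsmul_le_sum _ _ _ hmin

/-- A best `k`-term approximation is at least as close as any other `k`-sparse vector. -/
theorem IsLargestSupport.norm_sub_restrictTo_le {z x : EuclideanSpace ℝ (Fin N)} {k : ℕ}
    {S : Finset (Fin N)} (hS : IsLargestSupport z k S) (hx : IsSparse k x) :
    ‖z - restrictTo S z‖ ≤ ‖x - z‖ := by
  set R := Finset.univ.filter fun i => x i ≠ 0
  have hR := hS.norm_sdiff_le (R := R) hx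
  rw [← sq_le_sq₀ (norm_nonneg _) (norm_nonneg _), norm_sq_restrictTo, norm_sq_restrictTo] at hR
  have e1 : z - restrictTo S z = restrictTo Sᶜ z := by
    ext i
    by_cases hi : i ∈ S <;> simp [hi]
  have h2 : ‖restrictTo Rᶜ z‖ ≤ ‖x - z‖ := by
    have e2 : ‖restrictTo Rᶜ z‖ = ‖restrictTo Rᶜ (x - z)‖ := by
      rw [← norm_neg]
      congr 1
      ext i
      by_cases hi : x i = 0 <;> simp [R, hi]
    have h := norm_restrictTo_mono (Finset.subset_univ Rᶜ) (x - z)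
    rwa [restrictTo_eq_self (S := Finset.univ) (by simp), ← e2] at h
  refine le_trans ?_ h2
  rw [e1, ← sq_le_sq₀ (norm_nonneg _) (norm_nonneg _), norm_sq_restrictTo, norm_sq_restrictTo]
  have d1 := Finset.sum_sdiff_eq_sub (f := fun i => z i ^ 2) (Finset.subset_univ S)
  have d2 := Finset.sum_sdiff_eq_sub (f := fun i => z i ^ 2) (Finset.subset_univ R)
  have d3 := Finset.sum_sdiff_sub_sum_sdiff (s₁ := R) (s₂ := S) (f := fun i => z i ^ 2)
  rw [Finset.compl_eq_univ_sdiff, Finset.compl_eq_univ_sdiff]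
  linarith

theorem isUnit_gram_det (D : Matrix (Fin m) (Fin N) ℝ) {k : ℕ} (hδ : ripConst D k < 1)
    {S : Finset (Fin N)} (hS : S.card ≤ k) :
    IsUnit ((subCols D S).transpose * subCols D S).det := by
  rw [← Matrix.isUnit_iff_isUnit_det, ← Matrix.mulVec_injective_iff_isUnit]
  refine (injective_iff_map_eq_zero (Matrix.mulVecLin _)).mpr fun v hv => ?_
  rw [Matrix.mulVecLin_apply, ← Matrix.conjTranspose_eq_transpose_of_trivial,
    Matrix.conjTranspose_mul_self_mulVec_eq_zero] at hv
  set z : EuclideanSpace ℝ (Fin N) :=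
    WithLp.toLp 2 fun i => if h : i ∈ S then v ⟨i, h⟩ else 0
  have hzS : ∀ i ∉ S, z i = 0 := fun i hi => by simp [z, hi]
  have hDz : D.toEuclideanLin z = 0 := by
    ext i
    have h := congrFun hv i
    simp only [Matrix.mulVec, dotProduct, subCols, Matrix.submatrix_apply, id, Pi.zero_apply] at h
    rw [Matrix.toLpLin_apply]
    simp only [Matrix.mulVec, dotProduct, PiLp.zero_apply]
    rw [← h, ← Finset.sum_subset (Finset.subset_univ S) fun j _ hj => by rw [hzS j hj, mul_zero],
      ← Finset.sum_coe_sort]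
    refine Finset.sum_congr rfl fun j _ => ?_
    simp [z]
  have h := (ripConst_spec D k (isSparse_of_forall_notMem hS hzS)).1
  rw [hDz, norm_zero] at h
  have hz0 : z = 0 := by
    rw [← norm_eq_zero]
    by_contra hne
    have : 0 < ‖z‖ ^ 2 := by positivity
    nlinarith
  ext i
  have := congrArg (fun u : EuclideanSpace ℝ (Fin N) => u i) hz0
  simpa [z] using this

theorem represent_apply_of_notMem (D : Matrix (Fin m) (Fin N) ℝ) {S : Finset (Fin N)}
    (y : EuclideanSpace ℝ (Fin m)) {i : Fin N} (hi : i ∉ S) : represent D S y i = 0 := by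
  simp [represent, hi]

/-- Normal equations: the residual of the least-squares fit is orthogonal to the columns used. -/
theorem restrictTo_transpose_sub_represent (D : Matrix (Fin m) (Fin N) ℝ) {S : Finset (Fin N)}
    (hS : IsUnit ((subCols D S).transpose * subCols D S).det) (y : EuclideanSpace ℝ (Fin m)) :
    restrictTo S (D.transpose.toEuclideanLin (y - D.toEuclideanLin (represent D S y))) = 0 := by
  have e1 : D.toEuclideanLin (represent D S y) =
      WithLp.toLp 2 ((subCols D S).mulVec ((pinv (subCols D S)).mulVec y.ofLp)) := by
    ext i
    rw [Matrix.toLpLin_apply]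
    simp only [Matrix.mulVec, dotProduct]
    rw [← Finset.sum_subset (Finset.subset_univ S) fun j _ hj => by
        rw [represent_apply_of_notMem D y hj, mul_zero],
      ← Finset.sum_coe_sort]
    refine Finset.sum_congr rfl fun j _ => ?_
    simp [represent, subCols, Matrix.toLpLin_apply, Matrix.mulVec, dotProduct]
  have e2 : (subCols D S).transpose.mulVec
      (y.ofLp - (subCols D S).mulVec ((pinv (subCols D S)).mulVec y.ofLp)) = 0 := by
    rw [Matrix.mulVec_sub, Matrix.mulVec_mulVec, Matrix.mulVec_mulVec, pinv, ← Matrix.mul_assoc,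
      Matrix.mul_nonsing_inv _ hS, Matrix.one_mul, sub_self]
  ext i
  by_cases hi : i ∈ S
  · have h := congrFun e2 ⟨i, hi⟩
    rw [restrictTo_apply, if_pos hi, e1, Matrix.toLpLin_apply]
    simpa [Matrix.mulVec, dotProduct, subCols] using h
  · simp [hi]

theorem hasDerivAt_gaussianPDFReal (v : NNReal) (x : ℝ) :
    HasDerivAt (gaussianPDFReal 0 v) (-(x / v) * gaussianPDFReal 0 v x) x := by
  have h : HasDerivAt (fun y : ℝ => -(y - 0) ^ 2 / (2 * (v : ℝ))) (-(x / v)) x := by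
    have h1 := (((hasDerivAt_id x).sub_const 0).pow 2).neg.div_const (2 * (v : ℝ))
    convert! h1 using 1
    rcases eq_or_ne (v : ℝ) 0 with hv | hv
    · simp [hv]
    · simp
      field_simp
  have h2 := h.exp.const_mul (√(2 * Real.pi * v))⁻¹
  convert! h2 using 1
  rw [gaussianPDFReal]
  ring

theorem tendsto_gaussianPDFReal_atTop (v : NNReal) (hv : v ≠ 0) :
    Filter.Tendsto (gaussianPDFReal 0 v) Filter.atTop (nhds 0) := by
  have hv' : (0 : ℝ) < 2 * v := by positivity
  have h1 : Filter.Tendsto (fun y : ℝ => -((y - 0) ^ 2 / (2 * (v : ℝ)))) Filter.atTop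
      Filter.atBot := by
    refine Filter.tendsto_neg_atTop_atBot.comp (Filter.Tendsto.atTop_div_const hv' ?_)
    simp
  have h2 := (Real.tendsto_exp_atBot.comp h1).const_mul (√(2 * Real.pi * v))⁻¹
  rw [mul_zero] at h2
  refine h2.congr fun y => ?_
  simp [gaussianPDFReal, neg_div]

/-- Mills' inequality for the upper tail of a centred Gaussian. -/
theorem setIntegral_Ioi_gaussianPDFReal_lt (v : NNReal) (hv : v ≠ 0) {t : ℝ} (ht : 0 < t) :
    ∫ x in Set.Ioi t, gaussianPDFReal 0 v x < v / t * gaussianPDFReal 0 v t := by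
  have hv' : (0 : ℝ) < v := by positivity
  set F : ℝ → ℝ := fun x => -(v / t * gaussianPDFReal 0 v x)
  set F' : ℝ → ℝ := fun x => x / t * gaussianPDFReal 0 v x
  have hd : ∀ x, HasDerivAt F (F' x) x := fun x => by
    have h := ((hasDerivAt_gaussianPDFReal v x).const_mul ((v : ℝ) / t)).neg
    convert! h using 1
    simp only [F']
    field_simp
  have hlim : Filter.Tendsto F Filter.atTop (nhds 0) := by
    have h := ((tendsto_gaussianPDFReal_atTop v hv).const_mul ((v : ℝ) / t)).neg
    simpa using h
  have hpdf := fun x => gaussianPDFReal_pos 0 v x hv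
  have hnn : ∀ x ∈ Set.Ioi t, 0 ≤ F' x := fun x hx => by
    have : 0 < x := ht.trans hx
    have := hpdf x
    positivity
  have hint : IntegrableOn F' (Set.Ioi t) :=
    integrableOn_Ioi_deriv_of_nonneg (hd t).continuousAt.continuousWithinAt (fun x _ => hd x)
      hnn hlim
  have hval := integral_Ioi_of_hasDerivAt_of_tendsto (hd t).continuousAt.continuousWithinAt
    (fun x _ => hd x) hint hlim
  have hg : IntegrableOn (gaussianPDFReal 0 v) (Set.Ioi t) :=
    (integrable_gaussianPDFReal 0 v).integrableOn
  have hdiff : ∀ x ∈ Set.Ioi t, 0 < F' x - gaussianPDFReal 0 v x := fun x hx => by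
    have h1 : 1 < x / t := (one_lt_div ht).mpr hx
    have := hpdf x
    simp only [F']
    nlinarith
  have hpos : 0 < ∫ x in Set.Ioi t, (F' x - gaussianPDFReal 0 v x) := by
    rw [setIntegral_pos_iff_support_of_nonneg_ae
      (ae_restrict_of_forall_mem measurableSet_Ioi fun x hx => (hdiff x hx).le) (hint.sub hg)]
    have hsub : Set.Ioi t ⊆ Function.support fun x => F' x - gaussianPDFReal 0 v x :=
      fun x hx => (hdiff x hx).ne'
    rw [Set.inter_eq_right.mpr hsub]
    simp
  rw [integral_sub hint hg, hval] at hpos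
  simp only [F] at hpos
  linarith

theorem gaussianReal_abs_gt_lt (v : NNReal) (hv : v ≠ 0) {t : ℝ} (ht : 0 < t) :
    (gaussianReal 0 v).real {x | t < |x|} < 2 * (v / t * gaussianPDFReal 0 v t) := by
  have hpos : ∀ s, 0 ≤ ∫ x in s, gaussianPDFReal 0 v x := fun s =>
    integral_nonneg fun x => gaussianPDFReal_nonneg 0 v x
  have h1 : (gaussianReal 0 v).real (Set.Ioi t) = ∫ x in Set.Ioi t, gaussianPDFReal 0 v x := by
    rw [measureReal_def, gaussianReal_apply_eq_integral 0 hv, ENNReal.toReal_ofReal (hpos _)]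
  have h2 : (gaussianReal 0 v).real (Set.Iio (-t)) = (gaussianReal 0 v).real (Set.Ioi t) := by
    have h := gaussianReal_map_neg (μ := 0) (v := v)
    rw [neg_zero] at h
    conv_lhs => rw [← h]
    rw [map_measureReal_apply (by fun_prop) measurableSet_Iio]
    congr 1
    ext x
    simp
  have h3 : {x : ℝ | t < |x|} = Set.Ioi t ∪ Set.Iio (-t) := by
    ext x
    simp only [Set.mem_ofPred_eq, lt_abs, Set.mem_union, Set.mem_Ioi, Set.mem_Iio]
    constructor <;> rintro (h | h) <;> first | exact Or.inl h | exact Or.inr (by linarith)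
  rw [h3]
  refine (measureReal_union_le _ _).trans_lt ?_
  rw [h2, h1]
  linarith [setIntegral_Ioi_gaussianPDFReal_lt v hv ht]

/-- The correlation of white Gaussian noise with a unit vector is centred Gaussian with the same
variance. -/
theorem IsWhiteGaussianNoise.hasLaw_correlation {Ω : Type*} [MeasurableSpace Ω] {μ : Measure Ω}
    [IsProbabilityMeasure μ] {e : Ω → EuclideanSpace ℝ (Fin m)} {σ : ℝ}
    (he : IsWhiteGaussianNoise μ e σ) {D : Matrix (Fin m) (Fin N) ℝ}
    (hD : HasNormalizedColumns D) (j : Fin N) :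
    HasLaw (fun ω => D.transpose.toEuclideanLin (e ω) j)
      (gaussianReal 0 (Real.toNNReal (σ ^ 2))) μ := by
  set X : Fin m → Ω → ℝ := fun i ω => D i j * e ω i
  have hlaw : ∀ i, HasLaw (X i)
      (gaussianReal 0 (NNReal.mk (D i j ^ 2) (sq_nonneg _) * Real.toNNReal (σ ^ 2))) μ :=
    fun i => by simpa [X] using gaussianReal_const_mul (he.law i) (D i j)
  have hG : ∀ i, HasGaussianLaw (X i) μ := fun i => (hlaw i).hasGaussianLaw
  have hind : iIndepFun X μ := he.indep.comp (fun i x => D i j * x) fun i => by fun_prop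
  have hsum := iIndepFun.hasGaussianLaw_fun_sum hG hind
  have hfun : (fun ω => D.transpose.toEuclideanLin (e ω) j) = fun ω => ∑ i, X i ω := by
    ext ω
    simp [Matrix.toLpLin_apply, Matrix.mulVec, dotProduct, X]
  rw [hfun]
  refine ⟨hsum.aemeasurable, ?_⟩
  have hmean : ∀ i, ∫ ω, X i ω ∂μ = 0 := fun i => by
    rw [(hlaw i).integral_eq, integral_id_gaussianReal]
  have hvar : ∀ i, Var[X i; μ] = D i j ^ 2 * σ ^ 2 := fun i => by
    rw [(hlaw i).variance_eq, variance_id_gaussianReal]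
    rw [NNReal.coe_mul, Real.coe_toNNReal _ (sq_nonneg σ)]
    rfl
  rw [hsum.map_eq_gaussianReal, integral_finsetSum _ fun i _ => (hG i).integrable,
    show (fun ω => ∑ i, X i ω) = ∑ i, X i by ext; simp,
    IndepFun.variance_sum (fun i _ => (hG i).memLp_two) fun i _ k _ hik => hind.indepFun hik]
  simp only [hmean, hvar, Finset.sum_const_zero, ← Finset.sum_mul]
  have h1 := hD j
  have h2 : ∑ i, D i j ^ 2 = 1 := by
    have h := EuclideanSpace.real_norm_sq_eq (WithLp.toLp 2 fun i => D i j)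
    rw [h1] at h
    simpa using h.symm
  rw [h2, one_mul]

theorem gaussian_tail_eq {N : ℕ} (hN : 2 ≤ N) {σ a : ℝ} (hσ : 0 < σ) (ha : -1 < a) :
    N * (2 * ((Real.toNNReal (σ ^ 2) : ℝ) / (σ * √(2 * (1 + a) * Real.log N)) *
      gaussianPDFReal 0 (Real.toNNReal (σ ^ 2)) (σ * √(2 * (1 + a) * Real.log N)))) =
      (√(Real.pi * (1 + a) * Real.log N) * (N : ℝ) ^ a)⁻¹ := by
  have hN0 : (0 : ℝ) < N := by positivity
  have hlog : 0 < Real.log N := Real.log_pos (by exact_mod_cast hN)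
  have ha' : 0 < 1 + a := by linarith
  have hexp : Real.exp (-(σ * √(2 * (1 + a) * Real.log N) - 0) ^ 2 / (2 * σ ^ 2)) =
      ((N : ℝ) * (N : ℝ) ^ a)⁻¹ := by
    rw [sub_zero, mul_pow, Real.sq_sqrt (by positivity),
      show -(σ ^ 2 * (2 * (1 + a) * Real.log N)) / (2 * σ ^ 2) = -(Real.log N * (1 + a)) by
        field_simp,
      Real.exp_neg, ← Real.rpow_def_of_pos hN0, Real.rpow_add hN0, Real.rpow_one]
  have hs1 : √(2 * Real.pi * σ ^ 2) = √2 * √Real.pi * σ := by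
    rw [Real.sqrt_mul (by positivity), Real.sqrt_mul (by positivity), Real.sqrt_sq hσ.le]
  have hs2 : √(2 * (1 + a) * Real.log N) = √2 * √((1 + a) * Real.log N) := by
    rw [mul_assoc, Real.sqrt_mul (by positivity)]
  have hs3 : √(Real.pi * (1 + a) * Real.log N) = √Real.pi * √((1 + a) * Real.log N) := by
    rw [mul_assoc, Real.sqrt_mul (by positivity)]
  rw [gaussianPDFReal, Real.coe_toNNReal _ (sq_nonneg σ), hexp, hs1, hs2, hs3]
  have h2 : √2 ^ 2 = (2 : ℝ) := Real.sq_sqrt (by norm_num)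
  have : 0 < √((1 + a) * Real.log N) := Real.sqrt_pos.mpr (by positivity)
  have : 0 < √Real.pi := Real.sqrt_pos.mpr Real.pi_pos
  have : 0 < (N : ℝ) ^ a := Real.rpow_pos_of_pos hN0 a
  field_simp
  rw [h2]

/-- With the stated probability all correlations with the noise are below the threshold, and at
least one of them does not vanish. -/
theorem IsWhiteGaussianNoise.exists_event {Ω : Type*} [MeasurableSpace Ω] {μ : Measure Ω}
    [IsProbabilityMeasure μ] {e : Ω → EuclideanSpace ℝ (Fin m)} {σ : ℝ}
    (he : IsWhiteGaussianNoise μ e σ) (hσ : 0 < σ) (hN : 2 ≤ N) {D : Matrix (Fin m) (Fin N) ℝ}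
    (hD : HasNormalizedColumns D) {a : ℝ} (ha : -1 < a) :
    ∃ A : Set Ω, MeasurableSet A ∧
      1 - (√(Real.pi * (1 + a) * Real.log N) * (N : ℝ) ^ a)⁻¹ < μ.real A ∧
      ∀ ω ∈ A, (∀ j, |D.transpose.toEuclideanLin (e ω) j| ≤ σ * √(2 * (1 + a) * Real.log N)) ∧
        ∃ j, D.transpose.toEuclideanLin (e ω) j ≠ 0 := by
  have hlog : 0 < Real.log N := Real.log_pos (by exact_mod_cast hN)
  have ha' : 0 < 1 + a := by linarith
  set t := σ * √(2 * (1 + a) * Real.log N) with ht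
  have htpos : 0 < t := mul_pos hσ (Real.sqrt_pos.mpr (by positivity))
  have hv : Real.toNNReal (σ ^ 2) ≠ 0 := by
    simp only [ne_eq, Real.toNNReal_eq_zero, not_le]
    positivity
  set B : Fin N → Set Ω := fun j => {ω | t < |D.transpose.toEuclideanLin (e ω) j|}
  set Z : Set Ω := {ω | D.transpose.toEuclideanLin (e ω) ⟨0, by omega⟩ = 0}
  have hBm : ∀ j, μ.real (B j) < 2 * ((Real.toNNReal (σ ^ 2) : ℝ) / t *
      gaussianPDFReal 0 (Real.toNNReal (σ ^ 2)) t) := fun j => by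
    have h := (he.hasLaw_correlation hD j).measureReal_eq (p := fun x => t < |x|)
      (measurableSet_lt measurable_const measurable_norm)
    rw [h]
    exact gaussianReal_abs_gt_lt _ hv htpos
  have hZm : μ.real Z = 0 := by
    have h := (he.hasLaw_correlation hD ⟨0, by omega⟩).measureReal_eq (p := fun x => x = 0)
      (measurableSet_singleton 0)
    have := nullSingletonClass_gaussianReal (μ := 0) hv
    rw [h]
    simp [measureReal_def]
  refine ⟨(toMeasurable μ ((⋃ j, B j) ∪ Z))ᶜ, (measurableSet_toMeasurable _ _).compl, ?_, ?_⟩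
  · rw [probReal_compl_eq_one_sub (measurableSet_toMeasurable _ _), measureReal_def,
      measure_toMeasurable, ← measureReal_def]
    refine sub_lt_sub_left ?_ 1
    calc μ.real ((⋃ j, B j) ∪ Z) ≤ μ.real (⋃ j, B j) + μ.real Z := measureReal_union_le _ _
      _ ≤ ∑ j, μ.real (B j) := by
        rw [hZm, add_zero]
        exact measureReal_iUnion_fintype_le _
      _ < ∑ _j : Fin N, 2 * ((Real.toNNReal (σ ^ 2) : ℝ) / t *
          gaussianPDFReal 0 (Real.toNNReal (σ ^ 2)) t) :=
        Finset.sum_lt_sum_of_nonempty ⟨⟨0, by omega⟩, Finset.mem_univ _⟩ fun j _ => hBm j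
      _ = _ := by
        rw [Finset.sum_const, Finset.card_univ, Fintype.card_fin, nsmul_eq_mul, ht,
          gaussian_tail_eq hN hσ ha]
  · intro ω hω
    have h : ω ∉ (⋃ j, B j) ∪ Z := fun h' => hω (subset_toMeasurable μ _ h')
    rw [Set.mem_union, not_or, Set.mem_iUnion, not_exists] at h
    exact ⟨fun j => not_lt.mp (h.1 j), _, h.2⟩

/-- The selection step captures most of the energy of the current error `h`. -/
theorem norm_restrictTo_compl_select_le (D : Matrix (Fin m) (Fin N) ℝ) {K : ℕ} (hKN : K ≤ N)
    (hδ : 0 ≤ ripConst D (4 * K)) (e : EuclideanSpace ℝ (Fin m)) {h : EuclideanSpace ℝ (Fin N)}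
    {R S : Finset (Fin N)} (hR : R.card ≤ 2 * K) (hh : ∀ i ∉ R, h i = 0)
    (hS : IsLargestSupport (D.transpose.toEuclideanLin (D.toEuclideanLin h + e)) (2 * K) S) :
    ‖restrictTo Sᶜ h‖ ≤ 2 * ripConst D (4 * K) * ‖h‖ + 4 * noiseCorr D K e := by
  set n := D.transpose.toEuclideanLin e with hn
  set w := h - D.transpose.toEuclideanLin (D.toEuclideanLin h) with hw
  have hv : D.transpose.toEuclideanLin (D.toEuclideanLin h + e) = h - w + n := by
    rw [map_add, hw, sub_sub_cancel]
  have hScard : S.card ≤ 2 * K := hS.1.trans_le (min_le_left _ _)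
  have hU : (R ∪ S).card ≤ 4 * K := (Finset.card_union_le R S).trans (by omega)
  have hwU := norm_restrictTo_sub_gram_le D hδ hU (h := h) fun i hi =>
    hh i fun hiR => hi (Finset.mem_union_left S hiR)
  rw [← hw] at hwU
  have hsel := hS.norm_sdiff_le hR
  rw [hv] at hsel
  have hw1 := (norm_restrictTo_mono (Finset.sdiff_subset.trans Finset.subset_union_left :
    R \ S ⊆ R ∪ S) w).trans hwU
  have hw2 := (norm_restrictTo_mono (Finset.sdiff_subset.trans Finset.subset_union_right :
    S \ R ⊆ R ∪ S) w).trans hwU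
  have hn1 := norm_restrictTo_le_mul_noiseCorr D hKN e 2 (S := R \ S)
    ((Finset.card_le_card Finset.sdiff_subset).trans hR)
  have hn2 := norm_restrictTo_le_mul_noiseCorr D hKN e 2 (S := S \ R)
    ((Finset.card_le_card Finset.sdiff_subset).trans hScard)
  rw [← hn] at hn1 hn2
  push_cast at hn1 hn2
  have e1 : restrictTo Sᶜ h = restrictTo (R \ S) h := by
    ext i
    by_cases hiR : i ∈ R <;> by_cases hiS : i ∈ S <;> simp [hiR, hiS, hh]
  have e2 : restrictTo (R \ S) h =
      restrictTo (R \ S) (h - w + n) + restrictTo (R \ S) w - restrictTo (R \ S) n := by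
    rw [restrictTo_add, restrictTo_sub]
    abel
  have e3 : restrictTo (S \ R) (h - w + n) = restrictTo (S \ R) n - restrictTo (S \ R) w := by
    have : restrictTo (S \ R) h = 0 := by
      ext i
      by_cases hiR : i ∈ R <;> simp [hiR, hh]
    rw [restrictTo_add, restrictTo_sub, this]
    abel
  have h1 : ‖restrictTo (R \ S) h‖ ≤
      ‖restrictTo (R \ S) (h - w + n)‖ + ‖restrictTo (R \ S) w‖ + ‖restrictTo (R \ S) n‖ := by
    conv_lhs => rw [e2]
    exact (norm_sub_le _ _).trans (add_le_add_left (norm_add_le _ _) _)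
  have h2 := norm_sub_le (restrictTo (S \ R) n) (restrictTo (S \ R) w)
  rw [← e3] at h2
  rw [e1]
  linarith

/-- The least-squares fit on `S` is close to `x` if `S` captures most of `x`. -/
theorem norm_sub_represent_le (D : Matrix (Fin m) (Fin N) ℝ) {K : ℕ} (hKN : K ≤ N)
    (hδ : 0 ≤ ripConst D (4 * K)) (hδ' : ripConst D (4 * K) < 1) (e : EuclideanSpace ℝ (Fin m))
    {x : EuclideanSpace ℝ (Fin N)} (hx : IsSparse K x) {S : Finset (Fin N)}
    (hS : S.card ≤ 3 * K) :
    (1 - ripConst D (4 * K)) * ‖x - represent D S (D.toEuclideanLin x + e)‖ ≤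
      ‖restrictTo Sᶜ x‖ + 3 * noiseCorr D K e := by
  set y := D.toEuclideanLin x + e with hy
  set g := x - represent D S y with hg
  set R := Finset.univ.filter fun i => x i ≠ 0
  have hU : (R ∪ S).card ≤ 4 * K :=
    (Finset.card_union_le R S).trans (by have : R.card ≤ K := hx; omega)
  have hgU : ∀ i ∉ R ∪ S, g i = 0 := fun i hi => by
    rw [Finset.mem_union, not_or] at hi
    have hxi : x i = 0 := by simpa [R] using hi.1
    simp [g, hxi, represent_apply_of_notMem D y hi.2]
  have hnormal := restrictTo_transpose_sub_represent D
    (isUnit_gram_det D hδ' (by omega : S.card ≤ 4 * K)) y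
  have hres : y - D.toEuclideanLin (represent D S y) = D.toEuclideanLin g + e := by
    rw [hg, map_sub, hy]
    abel
  rw [hres, map_add, restrictTo_add] at hnormal
  have hw := (norm_restrictTo_mono Finset.subset_union_right _).trans
    (norm_restrictTo_sub_gram_le D hδ hU hgU)
  rw [restrictTo_sub, eq_neg_of_add_eq_zero_left hnormal, sub_neg_eq_add] at hw
  have hn := norm_restrictTo_le_mul_noiseCorr D hKN e 3 hS
  push_cast at hn
  have h1 : ‖restrictTo S g‖ ≤ ripConst D (4 * K) * ‖g‖ + 3 * noiseCorr D K e := by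
    have := norm_sub_le (restrictTo S g + restrictTo S (D.transpose.toEuclideanLin e))
      (restrictTo S (D.transpose.toEuclideanLin e))
    rw [add_sub_cancel_right] at this
    linarith
  have h2 : restrictTo Sᶜ g = restrictTo Sᶜ x := by
    ext i
    by_cases hi : i ∈ S <;> simp [g, hi, represent_apply_of_notMem]
  have h3 := norm_le_restrictTo_add_compl S g
  rw [h2] at h3
  linarith

/-- One CoSaMP iteration contracts the error up to the noise level. -/
theorem norm_sub_step_le (D : Matrix (Fin m) (Fin N) ℝ) {K : ℕ} (hKN : K ≤ N)
    (hδ : 0 ≤ ripConst D (4 * K)) (hδ' : ripConst D (4 * K) < 1) (e : EuclideanSpace ℝ (Fin m))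
    {x xhat : EuclideanSpace ℝ (Fin N)} (hx : IsSparse K x) {T TΔ T' : Finset (Fin N)}
    (hT : T.card ≤ K) (hxhat : ∀ i ∉ T, xhat i = 0)
    (select : IsLargestSupport
      (D.transpose.toEuclideanLin (D.toEuclideanLin x + e - D.toEuclideanLin xhat)) (2 * K) TΔ)
    (prune : IsLargestSupport (represent D (T ∪ TΔ) (D.toEuclideanLin x + e)) K T') :
    (1 - ripConst D (4 * K)) *
        ‖x - restrictTo T' (represent D (T ∪ TΔ) (D.toEuclideanLin x + e))‖ ≤
      4 * ripConst D (4 * K) * ‖x - xhat‖ + 14 * noiseCorr D K e := by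
  set R := Finset.univ.filter fun i => x i ≠ 0
  have hsel : D.toEuclideanLin x + e - D.toEuclideanLin xhat =
      D.toEuclideanLin (x - xhat) + e := by
    rw [map_sub]
    abel
  rw [hsel] at select
  have h1 := norm_restrictTo_compl_select_le D hKN hδ e (R := R ∪ T)
    ((Finset.card_union_le R T).trans (by have : R.card ≤ K := hx; omega))
    (fun i hi => by
      rw [Finset.mem_union, not_or] at hi
      have hxi : x i = 0 := by simpa [R] using hi.1
      simp [hxi, hxhat i hi.2]) select
  have hTΔ : TΔ.card ≤ 2 * K := select.1.trans_le (min_le_left _ _)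
  have h2 := norm_sub_represent_le D hKN hδ hδ' e hx (S := T ∪ TΔ)
    ((Finset.card_union_le T TΔ).trans (by omega))
  have h3 : ‖restrictTo (T ∪ TΔ)ᶜ x‖ ≤ ‖restrictTo TΔᶜ (x - xhat)‖ := by
    have e1 : restrictTo (T ∪ TΔ)ᶜ x = restrictTo (T ∪ TΔ)ᶜ (x - xhat) := by
      ext i
      by_cases hi : i ∈ T <;> simp [hi, hxhat]
    rw [e1]
    exact norm_restrictTo_mono (Finset.compl_subset_compl.mpr Finset.subset_union_right) _
  have h4 := prune.norm_sub_restrictTo_le hx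
  set p := represent D (T ∪ TΔ) (D.toEuclideanLin x + e)
  have h5 : ‖x - restrictTo T' p‖ ≤ 2 * ‖x - p‖ := by
    have := norm_add_le (x - p) (p - restrictTo T' p)
    rw [sub_add_sub_cancel] at this
    linarith
  nlinarith

theorem Iterate.card_le {D : Matrix (Fin m) (Fin N) ℝ} {K ℓ : ℕ} {y : EuclideanSpace ℝ (Fin m)}
    {T : Finset (Fin N)} {xhat : EuclideanSpace ℝ (Fin N)} (h : Iterate K D y ℓ T xhat) :
    T.card ≤ K := by
  cases h with
  | init => simp
  | step _ _ prune => exact prune.1.trans_le (min_le_left _ _)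

theorem Iterate.apply_eq_zero {D : Matrix (Fin m) (Fin N) ℝ} {K ℓ : ℕ}
    {y : EuclideanSpace ℝ (Fin m)} {T : Finset (Fin N)} {xhat : EuclideanSpace ℝ (Fin N)}
    (h : Iterate K D y ℓ T xhat) : ∀ i ∉ T, xhat i = 0 := by
  cases h with
  | init => simp
  | step _ _ _ =>
    intro i hi
    simp [hi]

/-- Linear convergence of CoSaMP down to the noise level. -/
theorem Iterate.norm_sub_le {D : Matrix (Fin m) (Fin N) ℝ} {K ℓ : ℕ} (hKN : K ≤ N)
    (hδ : 0 ≤ ripConst D (4 * K)) (hδ' : ripConst D (4 * K) ≤ 0.1)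
    {x : EuclideanSpace ℝ (Fin N)} (hx : IsSparse K x) {e : EuclideanSpace ℝ (Fin m)}
    {T : Finset (Fin N)} {xhat : EuclideanSpace ℝ (Fin N)}
    (h : Iterate K D (D.toEuclideanLin x + e) ℓ T xhat) :
    ‖x - xhat‖ ≤ ‖x‖ / 2 ^ ℓ + 28 / (1 - ripConst D (4 * K)) * noiseCorr D K e := by
  have hδ1 : 0 < 1 - ripConst D (4 * K) := by linarith
  have hε := noiseCorr_nonneg D K e
  induction h with
  | init =>
    simp only [sub_zero, pow_zero, div_one]
    have := mul_nonneg (div_nonneg (by norm_num : (0 : ℝ) ≤ 28) hδ1.le) hε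
    linarith
  | @step ℓ T xhat TΔ T' prev select prune ih =>
    have hs := norm_sub_step_le D hKN hδ (by linarith) e hx prev.card_le prev.apply_eq_zero
      select prune
    set E := ‖x - restrictTo T' (represent D (T ∪ TΔ) (D.toEuclideanLin x + e))‖
    have h1 : (1 - ripConst D (4 * K)) * E ≤
        (1 - ripConst D (4 * K)) * (‖x - xhat‖ / 2) + 14 * noiseCorr D K e := by
      nlinarith [norm_nonneg (x - xhat)]
    have h2 : E ≤ ‖x - xhat‖ / 2 + 14 / (1 - ripConst D (4 * K)) * noiseCorr D K e := by
      rw [← mul_le_mul_iff_right₀ hδ1]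
      refine h1.trans_eq ?_
      field_simp
    have h3 : ‖x‖ / 2 ^ (ℓ + 1) = ‖x‖ / 2 ^ ℓ / 2 := by rw [pow_succ, div_div]
    have h4 : 28 / (1 - ripConst D (4 * K)) = 2 * (14 / (1 - ripConst D (4 * K))) := by ring
    rw [h3]
    rw [h4] at ih ⊢
    linarith

theorem norm_div_two_pow_le {D : Matrix (Fin m) (Fin N) ℝ} {K ℓ : ℕ}
    {x : EuclideanSpace ℝ (Fin N)} {e : EuclideanSpace ℝ (Fin m)} (hε : 0 < noiseCorr D K e)
    (hℓ : iterationCount D K x e ≤ ℓ) : ‖x‖ / 2 ^ ℓ ≤ noiseCorr D K e := by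
  rcases (norm_nonneg x).eq_or_lt with h0 | h0
  · rw [← h0, zero_div]
    exact hε.le
  have h1 : Real.logb 2 (‖x‖ / noiseCorr D K e) ≤ ℓ := Nat.ceil_le.mp hℓ
  rw [Real.logb_le_iff_le_rpow one_lt_two (by positivity), Real.rpow_natCast,
    div_le_iff₀ hε] at h1
  rw [div_le_iff₀ (by positivity)]
  linarith

theorem noiseCorr_pos {D : Matrix (Fin m) (Fin N) ℝ} {K : ℕ} (hK : 1 ≤ K) (hKN : K ≤ N)
    {e : EuclideanSpace ℝ (Fin m)} {j : Fin N} (hj : D.transpose.toEuclideanLin e j ≠ 0) :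
    0 < noiseCorr D K e := by
  refine lt_of_lt_of_le ?_ (norm_restrictTo_le_noiseCorr D hKN e (S := {j}) (by simpa using hK))
  rw [norm_pos_iff]
  intro h
  have := congrArg (fun u : EuclideanSpace ℝ (Fin N) => u j) h
  rw [restrictTo_apply, if_pos (Finset.mem_singleton_self j)] at this
  exact hj this

theorem noiseCorr_sq_le {D : Matrix (Fin m) (Fin N) ℝ} {K : ℕ} {e : EuclideanSpace ℝ (Fin m)}
    {t : ℝ} (ht : ∀ j, |D.transpose.toEuclideanLin e j| ≤ t) :
    noiseCorr D K e ^ 2 ≤ K * t ^ 2 := by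
  have h : noiseCorr D K e ≤ √(K * t ^ 2) := Real.iSup_le (fun S => ?_) (Real.sqrt_nonneg _)
  · exact (Real.le_sqrt (noiseCorr_nonneg D K e) (by positivity)).mp h
  rw [norm_subCols_transpose]
  refine Real.le_sqrt_of_sq_le ?_
  rw [norm_sq_restrictTo]
  calc ∑ i ∈ S.1, D.transpose.toEuclideanLin e i ^ 2 ≤ S.1.card • t ^ 2 :=
        Finset.sum_le_card_nsmul _ _ _ fun i _ => sq_le_sq.mpr ((ht i).trans (le_abs_self t))
    _ = K * t ^ 2 := by rw [S.2, nsmul_eq_mul]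

theorem errorConst_le {δ : ℝ} (h1 : δ ≤ 0.1) : errorConst δ ≤ 34.1 := by
  have : 0 < 1 - δ := by linarith
  rw [errorConst, div_le_iff₀ (by positivity)]
  nlinarith

theorem one_add_le_errorConst {δ : ℝ} (h0 : 0 ≤ δ) (h1 : δ < 1) :
    1 + 28 / (1 - δ) ≤ errorConst δ := by
  have : 0 < 1 - δ := by linarith
  rw [errorConst, le_div_iff₀ (by positivity)]
  have : (1 + 28 / (1 - δ)) * (1 - δ) ^ 2 = (1 - δ) ^ 2 + 28 * (1 - δ) := by
    field_simp
  rw [this]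
  nlinarith

end CoSaMP

theorem mainTheorem2 {m N K : ℕ} (hN : 2 ≤ N) (hK : 1 ≤ K) (hKN : K ≤ N)
    (D : Matrix (Fin m) (Fin N) ℝ) (hD : CoSaMP.HasNormalizedColumns D)
    (hδ : CoSaMP.ripConst D (4 * K) ≤ 0.1)
    (x : EuclideanSpace ℝ (Fin N)) (hx : CoSaMP.IsSparse K x)
    (σ : ℝ) (hσ : 0 < σ) (a : ℝ) (ha : -1 < a)
    {Ω : Type*} [MeasurableSpace Ω] (μ : Measure Ω) [IsProbabilityMeasure μ]
    (e : Ω → EuclideanSpace ℝ (Fin m)) (he : CoSaMP.IsWhiteGaussianNoise μ e σ) :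
    CoSaMP.errorConst (CoSaMP.ripConst D (4 * K)) ≤ 34.1 ∧
    ∃ A : Set Ω, MeasurableSet A ∧
      1 - (√(Real.pi * (1 + a) * Real.log N) * (N : ℝ) ^ a)⁻¹ < μ.real A ∧
      ∀ ω ∈ A, ∀ ℓ : ℕ, CoSaMP.iterationCount D K x (e ω) ≤ ℓ →
        ∀ (T : Finset (Fin N)) (xhat : EuclideanSpace ℝ (Fin N)),
          CoSaMP.Iterate K D (D.toEuclideanLin x + e ω) ℓ T xhat →
          ‖x - xhat‖ ^ 2 ≤
            CoSaMP.errorConst (CoSaMP.ripConst D (4 * K)) ^ 2 * (2 * (1 + a) * Real.log N) *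
              (K * σ ^ 2) := by
  have hδ0 := CoSaMP.ripConst_nonneg D hD (k := 4 * K) (by omega) ⟨0, by omega⟩
  refine ⟨CoSaMP.errorConst_le hδ, ?_⟩
  obtain ⟨A, hA, hP, hgood⟩ := he.exists_event hσ hN hD ha
  refine ⟨A, hA, hP, fun ω hω ℓ hℓ T xhat hrun => ?_⟩
  obtain ⟨hle, j, hj⟩ := hgood ω hω
  have hε := CoSaMP.noiseCorr_pos hK hKN hj
  have h1 := hrun.norm_sub_le hKN hδ0 hδ hx
  have h2 := CoSaMP.norm_div_two_pow_le hε hℓ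
  have h3 := CoSaMP.one_add_le_errorConst hδ0 (by linarith)
  have h4 := CoSaMP.noiseCorr_sq_le (K := K) hle
  have hlog : 0 ≤ Real.log N := Real.log_natCast_nonneg N
  rw [mul_pow, Real.sq_sqrt (mul_nonneg (by linarith) hlog)] at h4
  have h5 : ‖x - xhat‖ ≤ CoSaMP.errorConst (CoSaMP.ripConst D (4 * K)) *
      CoSaMP.noiseCorr D K (e ω) := by
    nlinarith
  calc ‖x - xhat‖ ^ 2 ≤ CoSaMP.errorConst (CoSaMP.ripConst D (4 * K)) ^ 2 *
        CoSaMP.noiseCorr D K (e ω) ^ 2 := by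
        rw [← mul_pow]
        exact pow_le_pow_left₀ (norm_nonneg _) h5 2
    _ ≤ CoSaMP.errorConst (CoSaMP.ripConst D (4 * K)) ^ 2 *
        (K * (σ ^ 2 * (2 * (1 + a) * Real.log N))) := by gcongr
    _ = _ := by ring
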